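/- \textbf{Conventions.} For a finite alphabet $\Sigma$ (of indices of modalities), modal formulas over $\Sigma$ are built from $\bot$, propositional letters $p_0,p_1,\dots$, implication, and boxes $[e]$, $e\in\Sigma$. A $\Sigma$-frame is $F=(W,(R_e)_{e\in\Sigma})$ with $W\neq\varnothing$ and $R_e\subseteq W\times W$; truth in models on $F$ is Kripke truth, and $F\models\varphi$ ($\varphi$ is valid on $F$) means that $\varphi$ is true at all points under all valuations. A (normal) logic over $\Sigma$ is a set of formulas containing all classical tautologies and all $[e](p\to q)\to([e]p\to[e]q)$, closed under modus ponens, substitution and necessitation. For a set $\Phi$ of formulas over $\Sigma$, $\mathbf K_\Sigma+\Phi$ is the smallest logic over $\Sigma$ containing $\Phi$. A logic has the \emph{finite model property} if it is the set of all formulas valid on every frame of some class of finite frames. \textbf{Canonicity.} The canonical frame $F_L$ of a logic $L$ has as points the sets $x\supseteq L$ of formulas that are closed under modus ponens, never contain both $\varphi$ and $\neg\varphi$, and always contain one of them; $x\,R_e\,y$ iff $[e]\varphi\in x$ implies $\varphi\in y$ for all $\varphi$. $L$ is canonical if all its formulas are valid on $F_L$; a formula $\varphi$ over $\Sigma$ is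 canonical if $\mathbf K_\Sigma+\{\varphi\}$ is. \textbf{MFP.} $\mathrm{MFP}$ is the smallest set of first-order formulas (with equality and binary relation symbols $R_e$, $e\in\Sigma$) that contains all atoms $R_e(x,y)$ and $x=y$ and is closed under $\wedge$, $\vee$, $\forall v$, $\exists v$, and under passing from $B$ to $\forall x\forall y(R_e(x,y)\to B)$ and to $\forall x\forall y(x=y\to B)$, where $x,y$ are distinct variables. A modal formula $\varphi$ is a \emph{modal $\mathrm{MFP}$-formula} if there is $B\in\mathrm{MFP}$ such that for every $\Sigma$-frame $F$: $F\models\varphi$ iff $B$ is true in $F$ (under all assignments). \textbf{Fusion.} For logics $L_1,\dots,L_k$ over finite, pairwise disjoint alphabets $\Sigma_1,\dots,\Sigma_k$, the fusion $L_1*\dots*L_k$ is the smallest logic over $\Sigma_1\cup\dots\cup\Sigma_k$ containing $L_1\cup\dots\cup L_k$. \textbf{Expansions.} Let $\Sigma^\sharp$ be $\Sigma$ together with new symbols $e\circ f$, $e\cup f$, $e^+$ for $e,f\in\Sigma$. For a logic $L$ over $\Sigma$ let $L^\sharp$ be the smallest logic over $\Sigma^\sharp$ containing $L$ and, for all $e,c\in\Sigma$,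 the axioms $$[e\cup c]p\leftrightarrow[e]p\wedge[c]p,\quad [e\circ c]p\leftrightarrow[e][c]p,\quad [e^+]p\to[e]p,\quad [e^+]p\to[e][e^+]p,\quad [e^+](p\to[e]p)\to([e]p\to[e^+]p).$$ Put $L^{(0)}=L$ and $L^{(n+1)}=(L^{(n)})^\sharp$. \textbf{Corollary.} Let each of $L_1,\dots,L_k$ be either one of the unimodal logics $\mathbf K$, $\mathbf T$, $\mathbf{K4}$, $\mathbf{S4}$, $\mathbf{S5}$ (the extensions of the smallest unimodal logic by, respectively, no axiom; $\Box p\to p$; $\Box p\to\Box\Box p$; both of these; both of these and $p\to\Box\Diamond p$), or a logic of the form $\mathbf K_\Sigma+\Phi$, where $\Sigma$ is a finite alphabet and $\Phi$ is a (possibly infinite) set of canonical modal $\mathrm{MFP}$-formulas over $\Sigma$. Then for every $n<\omega$ the logic $(L_1*\dots*L_k)^{(n)}$ has the finite model property. -/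

import Mathlib

namespace PDLization

/-! ### Modal formulas, Kripke semantics -/

/-- Modal formulas over an alphabet `A` of modality indices; propositional letters are `ℕ`. -/
inductive Formula (A : Type) : Type where
  | bot : Formula A
  | var : ℕ → Formula A
  | imp : Formula A → Formula A → Formula A
  | box : A → Formula A → Formula A

namespace Formula

variable {A B : Type}

def neg (φ : Formula A) : Formula A := imp φ bot

def and (φ ψ : Formula A) : Formula A := neg (imp φ (neg ψ))

def iff (φ ψ : Formula A) : Formula A := and (imp φ ψ) (imp ψ φ)

def dia (e : A) (φ : Formula A) : Formula A := neg (box e (neg φ))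

/-- Simultaneous substitution of formulas for propositional letters. -/
def subst (σ : ℕ → Formula A) : Formula A → Formula A
  | bot => bot
  | var n => σ n
  | imp φ ψ => imp (subst σ φ) (subst σ ψ)
  | box e φ => box e (subst σ φ)

/-- Renaming of modality indices; along an injection this regards a formula over a smaller
alphabet as a formula over a bigger one. -/
def map (f : A → B) : Formula A → Formula B
  | bot => bot
  | var n => var n
  | imp φ ψ => imp (map f φ) (map f ψ)
  | box e φ => box (f e) (map f φ)

/-- Boolean evaluation, where letters and boxed formulas are treated as atoms. -/
def boolEval (v : Formula A → Prop) : Formula A → Prop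
  | bot => False
  | var n => v (var n)
  | imp φ ψ => boolEval v φ → boolEval v ψ
  | box e φ => v (box e φ)

/-- (Instances of) classical tautologies. -/
def IsTautology (φ : Formula A) : Prop := ∀ v : Formula A → Prop, boolEval v φ

/-- Truth at a point of the model `(W, R, V)`. -/
def Sat {W : Type} (R : A → W → W → Prop) (V : ℕ → W → Prop) : Formula A → W → Prop
  | bot, _ => False
  | var n, x => V n x
  | imp φ ψ, x => Sat R V φ x → Sat R V ψ x
  | box e φ, x => ∀ y, R e x y → Sat R V φ y

/-- Validity on `(W, R)`: truth at all points under all valuations. -/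
def ValidOn {W : Type} (R : A → W → W → Prop) (φ : Formula A) : Prop :=
  ∀ (V : ℕ → W → Prop) (x : W), Sat R V φ x

end Formula

open Formula

/-- A Kripke frame over `A`: a nonempty set with one binary relation for each index. -/
structure Frame (A : Type) where
  W : Type
  nonempty : Nonempty W
  rel : A → W → W → Prop

def Frame.Valid {A : Type} (F : Frame A) (φ : Formula A) : Prop := ValidOn F.rel φ

/-! ### Normal logics -/

/-- Normal modal logics over `A`. -/
structure IsNormalLogic {A : Type} (L : Set (Formula A)) : Prop where
  taut : ∀ φ, IsTautology φ → φ ∈ L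
  axK : ∀ e : A,
    imp (box e (imp (var 0) (var 1))) (imp (box e (var 0)) (box e (var 1))) ∈ L
  mp : ∀ φ ψ, imp φ ψ ∈ L → φ ∈ L → ψ ∈ L
  substitution : ∀ (σ : ℕ → Formula A) φ, φ ∈ L → subst σ φ ∈ L
  nec : ∀ (e : A) φ, φ ∈ L → box e φ ∈ L

/-- The smallest normal logic over `A` that contains the set of formulas `X`. -/
def leastLogic {A : Type} (X : Set (Formula A)) : Set (Formula A) :=
  {φ | ∀ L : Set (Formula A), IsNormalLogic L → X ⊆ L → φ ∈ L}

/-- The logic of a class of frames. -/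
def logicOf {A : Type} (C : Set (Frame A)) : Set (Formula A) :=
  {φ | ∀ F ∈ C, F.Valid φ}

/-- Finite model property: being the logic of some class of finite frames. -/
def HasFMP {A : Type} (L : Set (Formula A)) : Prop :=
  ∃ C : Set (Frame A), (∀ F ∈ C, Finite F.W) ∧ L = logicOf C

/-! ### Canonicity -/

/-- Points of the canonical frame of `L`: consistent complete theories, closed under modus
ponens, that contain `L`. -/
structure CanonPoint {A : Type} (L : Set (Formula A)) where
  carrier : Set (Formula A)
  contains : L ⊆ carrier
  mp : ∀ φ ψ, imp φ ψ ∈ carrier → φ ∈ carrier → ψ ∈ carrier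
  consistent : ∀ φ, ¬ (φ ∈ carrier ∧ neg φ ∈ carrier)
  complete : ∀ φ, φ ∈ carrier ∨ neg φ ∈ carrier

/-- The accessibility relations of the canonical frame of `L`. -/
def canonRel {A : Type} (L : Set (Formula A)) (e : A) (x y : CanonPoint L) : Prop :=
  ∀ φ, box e φ ∈ x.carrier → φ ∈ y.carrier

/-- A logic is canonical if it is valid on its canonical frame. -/
def IsCanonical {A : Type} (L : Set (Formula A)) : Prop :=
  ∀ φ ∈ L, ValidOn (canonRel L) φ

/-- A formula is canonical if the least normal logic containing it is canonical. -/
def IsCanonicalFormula {A : Type} (φ : Formula A) : Prop :=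
  IsCanonical (leastLogic {φ})

/-! ### First-order frame language and the fragment MFP -/

/-- First-order formulas with equality and with one binary relation symbol for each index in
`A`; individual variables are `ℕ`. -/
inductive FOFormula (A : Type) : Type where
  | fls : FOFormula A
  | rel : A → ℕ → ℕ → FOFormula A
  | eq : ℕ → ℕ → FOFormula A
  | and : FOFormula A → FOFormula A → FOFormula A
  | or : FOFormula A → FOFormula A → FOFormula A
  | imp : FOFormula A → FOFormula A → FOFormula A
  | all : ℕ → FOFormula A → FOFormula A
  | ex : ℕ → FOFormula A → FOFormula A

/-- First-order satisfaction in `(W, R)` under an assignment. -/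
def FOFormula.Sat {A W : Type} (R : A → W → W → Prop) : FOFormula A → (ℕ → W) → Prop
  | .fls, _ => False
  | .rel e x y, s => R e (s x) (s y)
  | .eq x y, s => s x = s y
  | .and P Q, s => Sat R P s ∧ Sat R Q s
  | .or P Q, s => Sat R P s ∨ Sat R Q s
  | .imp P Q, s => Sat R P s → Sat R Q s
  | .all v P, s => ∀ w : W, Sat R P (Function.update s v w)
  | .ex v P, s => ∃ w : W, Sat R P (Function.update s v w)

/-- The fragment MFP. -/
inductive IsMFP {A : Type} : FOFormula A → Prop where
  | rel (e : A) (x y : ℕ) : IsMFP (.rel e x y)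
  | eq (x y : ℕ) : IsMFP (.eq x y)
  | and {P Q : FOFormula A} : IsMFP P → IsMFP Q → IsMFP (.and P Q)
  | or {P Q : FOFormula A} : IsMFP P → IsMFP Q → IsMFP (.or P Q)
  | all (v : ℕ) {P : FOFormula A} : IsMFP P → IsMFP (.all v P)
  | ex (v : ℕ) {P : FOFormula A} : IsMFP P → IsMFP (.ex v P)
  | guardRel (e : A) {x y : ℕ} (hxy : x ≠ y) {P : FOFormula A} : IsMFP P →
      IsMFP (.all x (.all y (.imp (.rel e x y) P)))
  | guardEq {x y : ℕ} (hxy : x ≠ y) {P : FOFormula A} : IsMFP P →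
      IsMFP (.all x (.all y (.imp (.eq x y) P)))

/-- Modal MFP-formulas: those with a first-order equivalent on frames in MFP.  A first-order
formula is true in a frame if it holds under all assignments. -/
def IsModalMFP {A : Type} (φ : Formula A) : Prop :=
  ∃ P : FOFormula A, IsMFP P ∧
    ∀ F : Frame A, F.Valid φ ↔ ∀ s : ℕ → F.W, P.Sat F.rel s

/-! ### The logics K, T, K4, S4, S5 -/

def axT {A : Type} (e : A) : Formula A := imp (box e (var 0)) (var 0)

def ax4 {A : Type} (e : A) : Formula A := imp (box e (var 0)) (box e (box e (var 0)))

def axB {A : Type} (e : A) : Formula A := imp (var 0) (box e (dia e (var 0)))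

/-- `L` is one of the unimodal logics K, T, K4, S4, S5, where `e` is the only modality. -/
def IsBasicUnimodal {A : Type} (L : Set (Formula A)) : Prop :=
  ∃ e : A, (∀ f : A, f = e) ∧
    (L = leastLogic ∅ ∨ L = leastLogic {axT e} ∨ L = leastLogic {ax4 e} ∨
      L = leastLogic {axT e, ax4 e} ∨ L = leastLogic {axT e, ax4 e, axB e})

/-- `L` is axiomatized (over the least normal logic) by canonical modal MFP-formulas. -/
def IsCanonicalMFPLogic {A : Type} (L : Set (Formula A)) : Prop :=
  ∃ Φ : Set (Formula A), (∀ φ ∈ Φ, IsCanonicalFormula φ ∧ IsModalMFP φ) ∧ L = leastLogic Φ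

/-! ### Fusions and PDL-like expansions -/

/-- The fusion of logics over the disjoint union of their alphabets. -/
def fusion {k : ℕ} {A : Fin k → Type} (L : ∀ i, Set (Formula (A i))) :
    Set (Formula ((i : Fin k) × A i)) :=
  leastLogic (⋃ i, Formula.map (Sigma.mk i) '' L i)

/-- The alphabet `A` together with new symbols `e ∘ f`, `e ∪ f`, `e⁺` for `e, f` in `A`. -/
inductive Sharp (A : Type) : Type where
  | base : A → Sharp A
  | comp : A → A → Sharp A
  | union : A → A → Sharp A
  | plus : A → Sharp A

/-- The PDL-like axioms for the new modalities. -/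
inductive SharpAxiom {A : Type} : Formula (Sharp A) → Prop where
  | union (e c : A) : SharpAxiom
      (iff (box (.union e c) (var 0)) (and (box (.base e) (var 0)) (box (.base c) (var 0))))
  | comp (e c : A) : SharpAxiom
      (iff (box (.comp e c) (var 0)) (box (.base e) (box (.base c) (var 0))))
  | plusSub (e : A) : SharpAxiom
      (imp (box (.plus e) (var 0)) (box (.base e) (var 0)))
  | plusStep (e : A) : SharpAxiom
      (imp (box (.plus e) (var 0)) (box (.base e) (box (.plus e) (var 0))))
  | plusInd (e : A) : SharpAxiom
      (imp (box (.plus e) (imp (var 0) (box (.base e) (var 0))))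
        (imp (box (.base e) (var 0)) (box (.plus e) (var 0))))

/-- The least normal logic over `Sharp A` containing `L` and the PDL-like axioms. -/
def sharpLogic {A : Type} (L : Set (Formula A)) : Set (Formula (Sharp A)) :=
  leastLogic (Formula.map Sharp.base '' L ∪ {φ | SharpAxiom φ})

/-- The `n`-fold iterated alphabet. -/
def IterAlphabet (A : Type) : ℕ → Type
  | 0 => A
  | n + 1 => Sharp (IterAlphabet A n)

/-- The `n`-fold iterated expansion of a logic. -/
def iterLogic {A : Type} (L : Set (Formula A)) : (n : ℕ) → Set (Formula (IterAlphabet A n))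
  | 0 => L
  | n + 1 => sharpLogic (iterLogic L n)

end PDLization

/-!
To refute `φ ∉ L` on a finite frame for `L`, start with the canonical general frame of `L`, whose
admissible sets are the truth sets of formulas, and collapse it along a finite quotient map with
admissible fibres which does not split the sets relevant to `φ`. It remains to choose relations on
the quotient that validate `L` and are small enough for the truth of `φ` to be preserved. This is
possible for each of the logics `L i`, and the possibility is inherited by fusions and by `L♯`,
because all the logics share one quotient map: only finitely many admissible sets must be left
unsplit for a box to be preserved at a given argument, and the finite sets needed for several
logics can be united.

For `K, T, K4, S4, S5` the relations are the largest ones compatible with the axioms. For canonical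
MFP-logics they are the image of the canonical frame of the theory of a model in which each union of
fibres is named by a letter: this frame validates `L` by canonicity, it maps onto the finite
quotient because an ultrafilter on a finite set is principal, and MFP-sentences are preserved when
all relations are replaced by their images under a surjection. For `L♯`, interpret the new
modalities on the quotient in the intended way; the induction axiom, applied to the preimage of the
points reachable from a given one, shows that the quotient map is a homomorphism for `e⁺`.
-/

namespace PDLization

open Formula

/-! ### Kripke semantics -/

section Semantics

variable {A B W : Type}

theorem sat_map (f : A → B) (R : B → W → W → Prop) (V : ℕ → W → Prop) (φ : Formula A) (x : W) :
    Sat R V (φ.map f) x ↔ Sat (fun e => R (f e)) V φ x := by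
  induction φ generalizing x with
  | bot => rfl
  | var n => rfl
  | imp φ ψ ihφ ihψ => exact imp_congr (ihφ x) (ihψ x)
  | box e φ ih => exact forall₂_congr fun y _ => ih y

theorem validOn_map (f : A → B) (R : B → W → W → Prop) (φ : Formula A) :
    ValidOn R (φ.map f) ↔ ValidOn (fun e => R (f e)) φ :=
  forall₂_congr fun V x => sat_map f R V φ x

theorem sat_subst (R : A → W → W → Prop) (V : ℕ → W → Prop) (σ : ℕ → Formula A)
    (φ : Formula A) (x : W) :
    Sat R V (φ.subst σ) x ↔ Sat R (fun n => Sat R V (σ n)) φ x := by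
  induction φ generalizing x with
  | bot => rfl
  | var n => rfl
  | imp φ ψ ihφ ihψ => exact imp_congr (ihφ x) (ihψ x)
  | box e φ ih => exact forall₂_congr fun y _ => ih y

theorem boolEval_sat (R : A → W → W → Prop) (V : ℕ → W → Prop) (φ : Formula A) (x : W) :
    boolEval (fun ψ => Sat R V ψ x) φ ↔ Sat R V φ x := by
  induction φ with
  | bot => rfl
  | var n => rfl
  | imp φ ψ ihφ ihψ => exact imp_congr ihφ ihψ
  | box e φ _ => rfl

theorem sat_and {R : A → W → W → Prop} {V : ℕ → W → Prop} {φ ψ : Formula A} {x : W} :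
    Sat R V (Formula.and φ ψ) x ↔ Sat R V φ x ∧ Sat R V ψ x := by
  simp only [Formula.and, neg, Sat]
  tauto

theorem sat_iff {R : A → W → W → Prop} {V : ℕ → W → Prop} {φ ψ : Formula A} {x : W} :
    Sat R V (Formula.iff φ ψ) x ↔ (Sat R V φ x ↔ Sat R V ψ x) := by
  simp only [Formula.iff, sat_and, Sat]
  tauto

theorem isNormalLogic_validOn (R : A → W → W → Prop) : IsNormalLogic {φ | ValidOn R φ} where
  taut φ hφ V x := (boolEval_sat R V φ x).1 (hφ _)
  axK _ _ _ himp hφ y hxy := himp y hxy (hφ y hxy)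
  mp _ _ himp hφ V x := himp V x (hφ V x)
  substitution σ φ hφ V x := (sat_subst R V σ φ x).2 (hφ _ x)
  nec _ _ hφ V _ y _ := hφ V y

theorem isNormalLogic_leastLogic (Φ : Set (Formula A)) : IsNormalLogic (leastLogic Φ) where
  taut φ hφ _ hL _ := hL.taut φ hφ
  axK e _ hL _ := hL.axK e
  mp φ ψ himp hφ L hL hΦ := hL.mp φ ψ (himp L hL hΦ) (hφ L hL hΦ)
  substitution σ φ hφ L hL hΦ := hL.substitution σ φ (hφ L hL hΦ)
  nec e φ hφ L hL hΦ := hL.nec e φ (hφ L hL hΦ)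

theorem subset_leastLogic (Φ : Set (Formula A)) : Φ ⊆ leastLogic Φ :=
  fun _ hφ _ _ hΦ => hΦ hφ

theorem leastLogic_mono {Φ Ψ : Set (Formula A)} (h : Φ ⊆ Ψ) : leastLogic Φ ⊆ leastLogic Ψ :=
  fun _ hφ L hL hΨ => hφ L hL (h.trans hΨ)

theorem validOn_of_mem_leastLogic {R : A → W → W → Prop} {Φ : Set (Formula A)}
    (hΦ : ∀ φ ∈ Φ, ValidOn R φ) : ∀ φ ∈ leastLogic Φ, ValidOn R φ :=
  fun _ hφ => hφ _ (isNormalLogic_validOn R) hΦ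

section BoundedMorphism

variable {W' : Type} {R : A → W → W → Prop} {R' : A → W' → W' → Prop} {f : W → W'}

theorem sat_comp_of_boundedMorphism (forth : ∀ e x y, R e x y → R' e (f x) (f y))
    (back : ∀ e x y', R' e (f x) y' → ∃ y, R e x y ∧ f y = y') (V : ℕ → W' → Prop)
    (φ : Formula A) (x : W) : Sat R (fun n x => V n (f x)) φ x ↔ Sat R' V φ (f x) := by
  induction φ generalizing x with
  | bot => rfl
  | var n => rfl
  | imp φ ψ ihφ ihψ => exact imp_congr (ihφ x) (ihψ x)
  | box e φ ih =>
    refine ⟨fun hx y' hxy' => ?_, fun hx y hxy => (ih y).2 (hx _ (forth e x y hxy))⟩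
    obtain ⟨y, hxy, rfl⟩ := back e x y' hxy'
    exact (ih y).1 (hx y hxy)

theorem validOn_of_generatedSubframe (hf : Function.Injective f)
    (forth : ∀ e x y, R e x y → R' e (f x) (f y))
    (back : ∀ e x y', R' e (f x) y' → ∃ y, R e x y ∧ f y = y') {φ : Formula A}
    (h : ValidOn R' φ) : ValidOn R φ := by
  intro V x
  have key := (sat_comp_of_boundedMorphism forth back
    (fun n => Function.extend f (V n) fun _ => False) φ x).2 (h _ _)
  simpa only [hf.extend_apply] using key

end BoundedMorphism

end Semantics

/-! ### General frames -/

/-- The modal operator `[e]` on sets of points: the set of all `x` with `R e x y → y ∈ X`. -/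
def boxSet {A W : Type} (R : A → W → W → Prop) (e : A) (X : Set W) : Set W :=
  {x | ∀ y, R e x y → y ∈ X}

/-- General frames: Kripke frames with an algebra of admissible sets, closed under the modal
operators, in which the valuations take their values. -/
structure GeneralFrame (A : Type) extends Frame A where
  admissible : BooleanSubalgebra (Set W)
  boxSet_mem : ∀ e, ∀ X ∈ admissible, boxSet rel e X ∈ admissible

namespace GeneralFrame

variable {A B : Type}

/-- Validity on a general frame: truth at all points under all admissible valuations. -/
def Valid (F : GeneralFrame A) (φ : Formula A) : Prop :=
  ∀ V : ℕ → F.W → Prop, (∀ n, {x | V n x} ∈ F.admissible) → ∀ x, Sat F.rel V φ x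

/-- The general frame for a smaller or renamed alphabet, keeping the admissible sets. -/
def reindex (F : GeneralFrame B) (f : A → B) : GeneralFrame A where
  W := F.W
  nonempty := F.nonempty
  rel e := F.rel (f e)
  admissible := F.admissible
  boxSet_mem e := F.boxSet_mem (f e)

theorem valid_map {F : GeneralFrame B} {f : A → B} {φ : Formula A} :
    F.Valid (φ.map f) ↔ (F.reindex f).Valid φ :=
  forall₃_congr fun V _ x => sat_map f F.rel V φ x

variable {F : GeneralFrame A} {e : A} {X : Set F.W}

theorem setOf_sat_mem {V : ℕ → F.W → Prop} (hV : ∀ n, {x | V n x} ∈ F.admissible)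
    (φ : Formula A) : {x | Sat F.rel V φ x} ∈ F.admissible := by
  induction φ with
  | bot => exact BooleanSubalgebra.bot_mem
  | var n => exact hV n
  | imp φ ψ ihφ ihψ =>
    have himp : {x | Sat F.rel V (imp φ ψ) x}
        = {x | Sat F.rel V φ x}ᶜ ⊔ {x | Sat F.rel V ψ x} := Set.ext fun _ => imp_iff_not_or
    exact himp ▸ BooleanSubalgebra.sup_mem (BooleanSubalgebra.compl_mem ihφ) ihψ
  | box e φ ih => exact F.boxSet_mem e _ ih

theorem Valid.sat_const {φ : Formula A} (h : F.Valid φ) (hX : X ∈ F.admissible) (x : F.W) :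
    Sat F.rel (fun _ y => y ∈ X) φ x :=
  h _ (fun _ => hX) x

theorem Valid.boxSet_subset (h : F.Valid (axT e)) (hX : X ∈ F.admissible) :
    boxSet F.rel e X ⊆ X :=
  h.sat_const hX

theorem Valid.boxSet_subset_boxSet_boxSet (h : F.Valid (ax4 e)) (hX : X ∈ F.admissible) :
    boxSet F.rel e X ⊆ boxSet F.rel e (boxSet F.rel e X) :=
  h.sat_const hX

theorem Valid.mem_of_rel_of_mem_boxSet (h : F.Valid (axB e)) (hX : X ∈ F.admissible) {x y : F.W}
    (hxy : F.rel e x y) (hy : y ∈ boxSet F.rel e X) : x ∈ X := by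
  by_contra hx
  exact h.sat_const (BooleanSubalgebra.compl_mem hX) x hx y hxy fun z hyz hz => hz (hy z hyz)

end GeneralFrame

/-! ### Definable filtrations -/

/-- The unions of fibres of `π`. -/
def saturatedSets {W Q : Type} (π : W → Q) : Set (Set W) := Set.range (Set.preimage π)

/-- A surjection onto a finite set whose fibres are admissible. -/
structure GeneralFrame.IsFiniteQuotient {A Q : Type} (F : GeneralFrame A) (π : F.W → Q) :
    Prop where
  finite : Finite Q
  surjective : Function.Surjective π
  preimage_mem : ∀ s : Set Q, π ⁻¹' s ∈ F.admissible

/-- `supp e X` is a finite set of admissible sets, for all `e` and all admissible `X`. In a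
filtration, it contains the sets that must not be split for `[e]` to be preserved at `X`. -/
def GeneralFrame.IsFiniteSupport {A : Type} (F : GeneralFrame A)
    (supp : A → Set F.W → Set (Set F.W)) : Prop :=
  ∀ e, ∀ X ∈ F.admissible, (supp e X).Finite ∧ supp e X ⊆ F.admissible

/-- The relations `S` filtrate the relations `R` along `π`: they contain the images of the `R e`,
and `[e]` is preserved at each union of fibres whose support `supp e` is not split by `π`. -/
structure IsFiltration {A W Q : Type} (R : A → W → W → Prop) (supp : A → Set W → Set (Set W))
    (π : W → Q) (S : A → Q → Q → Prop) : Prop where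
  map_rel : ∀ e x y, R e x y → S e (π x) (π y)
  boxSet_subset : ∀ e s, supp e (π ⁻¹' s) ⊆ saturatedSets π →
    boxSet R e (π ⁻¹' s) ⊆ π ⁻¹' boxSet S e s

/-- Every general frame for `L` has filtrations that validate `L`, along all finite quotients. The
support is chosen before the quotient, so one quotient serves several logics at once. -/
def AdmitsFiltration {A : Type} (L : Set (Formula A)) : Prop :=
  ∀ F : GeneralFrame A, (∀ φ ∈ L, F.Valid φ) → ∃ supp, F.IsFiniteSupport supp ∧
    ∀ (Q : Type) (π : F.W → Q), F.IsFiniteQuotient π →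
      ∃ S : A → Q → Q → Prop, IsFiltration F.rel supp π S ∧ ∀ φ ∈ L, ValidOn S φ

section Filtration

variable {A W Q : Type}

theorem IsFiltration.boxSet_preimage {R : A → W → W → Prop} {supp : A → Set W → Set (Set W)}
    {π : W → Q} {S : A → Q → Q → Prop} (hS : IsFiltration R supp π S) {e : A} {s : Set Q}
    (hs : supp e (π ⁻¹' s) ⊆ saturatedSets π) :
    boxSet R e (π ⁻¹' s) = π ⁻¹' boxSet S e s :=
  (hS.boxSet_subset e s hs).antisymm fun x hx y hxy => hx (π y) (hS.map_rel e x y hxy)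

theorem AdmitsFiltration.of_boxSet_support {L : Set (Formula A)}
    (h : ∀ F : GeneralFrame A, (∀ φ ∈ L, F.Valid φ) →
      ∀ (Q : Type) (π : F.W → Q), F.IsFiniteQuotient π → ∃ S : A → Q → Q → Prop,
        (∀ e x y, F.rel e x y → S e (π x) (π y)) ∧
        (∀ e s t, boxSet F.rel e (π ⁻¹' s) = π ⁻¹' t → t ⊆ boxSet S e s) ∧
        ∀ φ ∈ L, ValidOn S φ) :
    AdmitsFiltration L := by
  refine fun F hF => ⟨fun e X => {boxSet F.rel e X}, fun e X hX =>
    ⟨Set.finite_singleton _, Set.singleton_subset_iff.2 (F.boxSet_mem e X hX)⟩, fun Q π hπ => ?_⟩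
  obtain ⟨S, map_rel, boxSet_subset, hSL⟩ := h F hF Q π hπ
  refine ⟨S, ⟨map_rel, fun e s hs => ?_⟩, hSL⟩
  obtain ⟨t, ht⟩ := Set.singleton_subset_iff.1 hs
  exact ht ▸ Set.preimage_mono (boxSet_subset e s t ht.symm)

theorem GeneralFrame.exists_isFiniteQuotient (F : GeneralFrame A) {K : Set (Set F.W)}
    (hK : K.Finite) (hKF : K ⊆ F.admissible) :
    ∃ (Q : Type) (π : F.W → Q), F.IsFiniteQuotient π ∧ K ⊆ saturatedSets π := by
  have := hK.to_subtype
  let τ : F.W → K → Prop := fun x X => x ∈ X.1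
  have fibre_mem (q : K → Prop) : τ ⁻¹' {q} ∈ F.admissible := by
    have hfibre : τ ⁻¹' {q} = ⨅ X : K, {x | x ∈ X.1 ↔ q X} := by
      ext x
      simp [τ, funext_iff]
    rw [hfibre]
    refine BooleanSubalgebra.iInf_mem fun X => ?_
    by_cases hq : q X
    · simp only [hq, iff_true]
      exact hKF X.2
    · simp only [hq, iff_false]
      exact BooleanSubalgebra.compl_mem (hKF X.2)
  have preimage_mem (s : Set (K → Prop)) : τ ⁻¹' s ∈ F.admissible := by
    rw [← Set.biUnion_preimage_singleton]
    exact BooleanSubalgebra.biSup_mem s.toFinite fun q _ => fibre_mem q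
  refine ⟨Set.range τ, Set.rangeFactorization τ,
    ⟨inferInstance, Set.rangeFactorization_surjective, fun s => ?_⟩, fun X hX => ?_⟩
  · rw [← Set.preimage_image_eq s Subtype.val_injective]
    exact preimage_mem _
  · exact ⟨{q | q.1 ⟨X, hX⟩}, rfl⟩

end Filtration

/-! ### Logics axiomatized by reflexivity, transitivity and symmetry -/

/-- `L` is axiomatized by some of the axioms T, 4 and B, each for an arbitrary set of
modalities. -/
def IsT4BLogic {A : Type} (L : Set (Formula A)) : Prop :=
  ∃ Φ : Set (Formula A), (∀ φ ∈ Φ, ∃ e, φ = axT e ∨ φ = ax4 e ∨ φ = axB e) ∧ L = leastLogic Φ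

theorem IsBasicUnimodal.isT4BLogic {A : Type} {L : Set (Formula A)} (hL : IsBasicUnimodal L) :
    IsT4BLogic L := by
  obtain ⟨e, -, rfl | rfl | rfl | rfl | rfl⟩ := hL <;>
    exact ⟨_, fun φ hφ => ⟨e, by aesop⟩, rfl⟩

section Lemmon

variable {A Q : Type}

theorem validOn_axT {S : A → Q → Q → Prop} {e : A} (h : ∀ q, S e q q) : ValidOn S (axT e) :=
  fun _ q hq => hq q (h q)

theorem validOn_ax4 {S : A → Q → Q → Prop} {e : A}
    (h : ∀ p q r, S e p q → S e q r → S e p r) : ValidOn S (ax4 e) :=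
  fun _ p hp q hpq r hqr => hp r (h p q r hpq hqr)

theorem validOn_axB {S : A → Q → Q → Prop} {e : A} (h : ∀ q r, S e q r → S e r q) :
    ValidOn S (axB e) :=
  fun _ q hq r hqr hr => hr q (h q r hqr) hq

/-- The largest filtration relation for `[e]`, made transitive if `L` contains the axiom 4: the
second conjunct is Lemmon's condition. -/
def lemmonStep {W : Type} (L : Set (Formula A)) (R : A → W → W → Prop) (π : W → Q) (e : A)
    (q r : Q) : Prop :=
  ∀ s t, boxSet R e (π ⁻¹' s) = π ⁻¹' t → q ∈ t → r ∈ s ∧ (ax4 e ∈ L → r ∈ t)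

/-- The largest filtration relation for `[e]` that satisfies the axioms 4 and B if they belong
to `L`. -/
def lemmonRel {W : Type} (L : Set (Formula A)) (R : A → W → W → Prop) (π : W → Q) (e : A)
    (q r : Q) : Prop :=
  lemmonStep L R π e q r ∧ (axB e ∈ L → lemmonStep L R π e r q)

variable {L : Set (Formula A)} {F : GeneralFrame A} {π : F.W → Q} {e : A}

theorem lemmonStep_map (hF : ∀ φ ∈ L, F.Valid φ) (hπ : F.IsFiniteQuotient π) {x y : F.W}
    (hxy : F.rel e x y) : lemmonStep L F.rel π e (π x) (π y) := by
  intro s t hst (hx : x ∈ π ⁻¹' t)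
  rw [← hst] at hx
  refine ⟨hx y hxy, fun h4 => ?_⟩
  change y ∈ π ⁻¹' t
  rw [← hst]
  exact (hF _ h4).boxSet_subset_boxSet_boxSet (hπ.preimage_mem s) hx y hxy

theorem lemmonStep_map_swap (hF : ∀ φ ∈ L, F.Valid φ) (hπ : F.IsFiniteQuotient π)
    (hB : axB e ∈ L) {x y : F.W} (hxy : F.rel e x y) :
    lemmonStep L F.rel π e (π y) (π x) := by
  intro s t hst (hy : y ∈ π ⁻¹' t)
  rw [← hst] at hy
  have hs := hπ.preimage_mem s
  refine ⟨(hF _ hB).mem_of_rel_of_mem_boxSet hs hxy hy, fun h4 => ?_⟩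
  change x ∈ π ⁻¹' t
  rw [← hst]
  exact (hF _ hB).mem_of_rel_of_mem_boxSet (F.boxSet_mem e _ hs) hxy
    ((hF _ h4).boxSet_subset_boxSet_boxSet hs hy)

theorem lemmonStep_refl (hF : ∀ φ ∈ L, F.Valid φ) (hπ : F.IsFiniteQuotient π)
    (hT : axT e ∈ L) (q : Q) : lemmonStep L F.rel π e q q := by
  intro s t hst hq
  obtain ⟨x, rfl⟩ := hπ.surjective q
  have hx : x ∈ boxSet F.rel e (π ⁻¹' s) := hst ▸ hq
  exact ⟨(hF _ hT).boxSet_subset (hπ.preimage_mem s) hx, fun _ => hq⟩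

theorem lemmonStep_trans {W : Type} {R : A → W → W → Prop} {π : W → Q} (h4 : ax4 e ∈ L)
    {p q r : Q} (hpq : lemmonStep L R π e p q) (hqr : lemmonStep L R π e q r) :
    lemmonStep L R π e p r :=
  fun s t hst hp => hqr s t hst ((hpq s t hst hp).2 h4)

theorem IsT4BLogic.admitsFiltration (hL : IsT4BLogic L) : AdmitsFiltration L := by
  obtain ⟨Φ, hΦ, rfl⟩ := hL
  refine .of_boxSet_support fun F hF Q π hπ => ⟨lemmonRel (leastLogic Φ) F.rel π, ?_, ?_, ?_⟩
  · exact fun e x y hxy => ⟨lemmonStep_map hF hπ hxy, fun hB => lemmonStep_map_swap hF hπ hB hxy⟩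
  · exact fun e s t hst q hq r hqr => (hqr.1 s t hst hq).1
  · refine validOn_of_mem_leastLogic fun φ hφ => ?_
    have hφL := subset_leastLogic Φ hφ
    obtain ⟨e, rfl | rfl | rfl⟩ := hΦ φ hφ
    · exact validOn_axT fun q => ⟨lemmonStep_refl hF hπ hφL q, fun _ => lemmonStep_refl hF hπ hφL q⟩
    · exact validOn_ax4 fun p q r hpq hqr => ⟨lemmonStep_trans hφL hpq.1 hqr.1,
        fun hB => lemmonStep_trans hφL (hqr.2 hB) (hpq.2 hB)⟩
    · exact validOn_axB fun q r hqr => ⟨hqr.2 hφL, fun _ => hqr.1⟩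

end Lemmon

/-! ### Canonical MFP-logics -/

section MFP

variable {A P Q : Type} {R : A → P → P → Prop} {ρ : P → Q}

theorem IsMFP.sat_map_of_surjective (hρ : Function.Surjective ρ) {B : FOFormula A} (hB : IsMFP B)
    {s : ℕ → P} (h : B.Sat R s) : B.Sat (fun e => Relation.Map (R e) ρ ρ) (ρ ∘ s) := by
  induction hB generalizing s with
  | rel e x y => exact ⟨_, _, h, rfl, rfl⟩
  | eq x y => exact congrArg ρ h
  | and _ _ ih₁ ih₂ => exact h.imp ih₁ ih₂
  | or _ _ ih₁ ih₂ => exact h.imp ih₁ ih₂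
  | all v _ ih =>
    intro q
    obtain ⟨w, rfl⟩ := hρ q
    exact Function.comp_update ρ s v w ▸ ih (h w)
  | ex v _ ih =>
    obtain ⟨w, hw⟩ := h
    exact ⟨ρ w, Function.comp_update ρ s v w ▸ ih hw⟩
  | @guardRel e x y hxy B _ ih =>
    rintro q r ⟨a, b, hab, ha, hb⟩
    simp only [Function.update_self, Function.update_of_ne hxy] at ha hb
    subst ha hb
    rw [← Function.comp_update, ← Function.comp_update]
    refine ih (h a b ?_)
    simpa only [FOFormula.Sat, Function.update_self, Function.update_of_ne hxy] using hab
  | @guardEq x y hxy B _ ih =>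
    intro q r hqr
    simp only [FOFormula.Sat, Function.update_self, Function.update_of_ne hxy] at hqr
    subst hqr
    obtain ⟨a, rfl⟩ := hρ q
    rw [← Function.comp_update, ← Function.comp_update]
    refine ih (h a a ?_)
    simp only [FOFormula.Sat, Function.update_self, Function.update_of_ne hxy]

theorem IsModalMFP.validOn_map_of_surjective [Nonempty P] (hρ : Function.Surjective ρ)
    {φ : Formula A} (hφ : IsModalMFP φ) (h : ValidOn R φ) :
    ValidOn (fun e => Relation.Map (R e) ρ ρ) φ := by
  obtain ⟨B, hB, hcorr⟩ := hφ
  refine (hcorr ⟨Q, .map ρ ‹_›, _⟩).2 fun s => ?_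
  obtain ⟨s, rfl⟩ := hρ.comp_left s
  exact hB.sat_map_of_surjective hρ ((hcorr ⟨P, ‹_›, R⟩).1 h s)

end MFP

section ModelTheory

variable {A W : Type}

theorem CanonPoint.carrier_injective {L : Set (Formula A)} :
    Function.Injective (CanonPoint.carrier : CanonPoint L → Set (Formula A)) := by
  rintro ⟨⟩ ⟨⟩ rfl
  rfl

theorem validOn_canonRel_of_subset {L T : Set (Formula A)} (hLT : L ⊆ T)
    (nec : ∀ e φ, φ ∈ T → box e φ ∈ T) {φ : Formula A} (h : ValidOn (canonRel L) φ) :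
    ValidOn (canonRel T) φ := by
  let restrict (x : CanonPoint T) : CanonPoint L := { x with contains := hLT.trans x.contains }
  have restrict_injective : Function.Injective restrict := fun x y hxy =>
    CanonPoint.carrier_injective (congrArg CanonPoint.carrier hxy :)
  refine validOn_of_generatedSubframe restrict_injective (fun e x y hxy => hxy)
    (fun e x y hxy => ?_) h
  exact ⟨{ y with contains := fun φ hφ => hxy φ (x.contains (nec e φ hφ)) }, hxy, rfl⟩

/-- The formulas true throughout the model `(W, R, V)`. -/
def modelTheory (R : A → W → W → Prop) (V : ℕ → W → Prop) : Set (Formula A) :=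
  {φ | ∀ x, Sat R V φ x}

variable {R : A → W → W → Prop} {V : ℕ → W → Prop}

theorem box_mem_modelTheory (e : A) (φ : Formula A) (hφ : φ ∈ modelTheory R V) :
    box e φ ∈ modelTheory R V :=
  fun _ y _ => hφ y

/-- The formulas true at a point of a model, as a point of the canonical frame of the theory of
this model. -/
def pointTheory (R : A → W → W → Prop) (V : ℕ → W → Prop) (x : W) :
    CanonPoint (modelTheory R V) where
  carrier := {φ | Sat R V φ x}
  contains _ hφ := hφ x
  mp _ _ himp hφ := himp hφ
  consistent _ h := h.2 h.1
  complete φ := Classical.em (Sat R V φ x)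

theorem canonRel_pointTheory {e : A} {x y : W} (hxy : R e x y) :
    canonRel (modelTheory R V) e (pointTheory R V x) (pointTheory R V y) :=
  fun _ hx => hx y hxy

variable {Q : Type} [Finite Q] {π : W → Q} {name : Set Q → Formula A}

theorem CanonPoint.exists_forall_name_mem_iff (hname : ∀ s x, Sat R V (name s) x ↔ π x ∈ s)
    (y : CanonPoint (modelTheory R V)) : ∃ q, ∀ s, name s ∈ y.carrier ↔ q ∈ s := by
  let f : Filter Q :=
    { sets := {s | name s ∈ y.carrier}
      univ_sets := y.contains fun x => (hname _ x).2 trivial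
      sets_of_superset := fun {s t} hs hst => y.mp _ _
        (y.contains fun x hx => (hname t x).2 (hst ((hname s x).1 hx))) hs
      inter_sets := fun {s t} hs ht => y.mp _ _ (y.mp _ _
        (y.contains fun x hx hx' => (hname _ x).2 ⟨(hname s x).1 hx, (hname t x).1 hx'⟩) hs) ht }
  have compl_notMem_iff (s : Set Q) : sᶜ ∉ f ↔ s ∈ f := by
    constructor
    · intro hsc
      refine y.mp (neg (name sᶜ)) _ (y.contains fun x hx => ?_) ((y.complete _).resolve_left hsc)
      exact (hname s x).2 (not_not.1 fun hs => hx ((hname sᶜ x).2 hs))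
    · intro hs hsc
      refine y.consistent _ ⟨hs, y.mp (name sᶜ) _ (y.contains fun x hx hx' => ?_) hsc⟩
      exact (hname sᶜ x).1 hx ((hname s x).1 hx')
  obtain ⟨q, hq⟩ := (Ultrafilter.ofComplNotMemIff f compl_notMem_iff).eq_pure_of_finite
  have mem_iff (s : Set Q) : s ∈ Ultrafilter.ofComplNotMemIff f compl_notMem_iff ↔ q ∈ s := by
    rw [hq, Ultrafilter.mem_pure]
  exact ⟨q, mem_iff⟩

end ModelTheory

theorem IsCanonicalMFPLogic.admitsFiltration {A : Type} {L : Set (Formula A)}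
    (hL : IsCanonicalMFPLogic L) : AdmitsFiltration L := by
  obtain ⟨Φ, hΦ, rfl⟩ := hL
  refine .of_boxSet_support fun F hF Q π hπ => ?_
  have := hπ.finite
  obtain ⟨U, hU⟩ := exists_surjective_nat (Set Q)
  let V : ℕ → F.W → Prop := fun n x => π x ∈ U n
  let T := modelTheory F.rel V
  have hLT : leastLogic Φ ⊆ T := fun φ hφ => hF φ hφ V fun n => hπ.preimage_mem (U n)
  choose letter hletter using hU
  have hname (s : Set Q) (x : F.W) : Sat F.rel V (var (letter s)) x ↔ π x ∈ s := by
    simp only [Sat, V, hletter]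
  choose ρ hρ using CanonPoint.exists_forall_name_mem_iff (A := A) (R := F.rel) hname
  have ρ_pointTheory (x : F.W) : ρ (pointTheory F.rel V x) = π x :=
    (hρ (pointTheory F.rel V x) {π x}).1 ((hname {π x} x).2 rfl)
  have ρ_surjective : Function.Surjective ρ := fun q =>
    (hπ.surjective q).imp' (pointTheory F.rel V) fun x hx => (ρ_pointTheory x).trans hx
  have : Nonempty (CanonPoint T) := F.nonempty.map (pointTheory F.rel V)
  refine ⟨fun e => Relation.Map (canonRel T e) ρ ρ, fun e x y hxy => ?_, fun e s t hst => ?_,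
    validOn_of_mem_leastLogic fun φ hφ => ?_⟩
  · exact ⟨_, _, canonRel_pointTheory hxy, ρ_pointTheory x, ρ_pointTheory y⟩
  · rintro _ hq _ ⟨x, y, hxy, rfl, rfl⟩
    have hbox : imp (var (letter t)) (box e (var (letter s))) ∈ T := fun z hz w hzw =>
      (hname s w).2 ((hst ▸ (hname t z).1 hz : z ∈ boxSet F.rel e (π ⁻¹' s)) w hzw)
    exact (hρ y s).1 (hxy _ (x.mp _ _ (x.contains hbox) ((hρ x t).2 hq)))
  · obtain ⟨hcanonical, hMFP⟩ := hΦ φ hφ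
    have hφT : leastLogic {φ} ⊆ T :=
      (leastLogic_mono (Set.singleton_subset_iff.2 hφ)).trans hLT
    exact hMFP.validOn_map_of_surjective ρ_surjective (validOn_canonRel_of_subset hφT
      box_mem_modelTheory (hcanonical φ (subset_leastLogic _ rfl)))

/-! ### Fusions -/

/-- The fusion of an arbitrary family of logics; for families indexed by `Fin k` this is
`fusion`. -/
def iFusion {ι : Type} {A : ι → Type} (L : ∀ i, Set (Formula (A i))) :
    Set (Formula ((i : ι) × A i)) :=
  leastLogic (⋃ i, Formula.map (Sigma.mk i) '' L i)

theorem AdmitsFiltration.iFusion {ι : Type} {A : ι → Type} {L : ∀ i, Set (Formula (A i))}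
    (hL : ∀ i, AdmitsFiltration (L i)) : AdmitsFiltration (iFusion L) := by
  intro F hF
  have valid_reindex (i : ι) : ∀ φ ∈ L i, (F.reindex (Sigma.mk i)).Valid φ := fun φ hφ =>
    GeneralFrame.valid_map.1 (hF _ (subset_leastLogic _ (Set.mem_iUnion.2 ⟨i, φ, hφ, rfl⟩)))
  choose supp hsupp hS using fun i => hL i _ (valid_reindex i)
  refine ⟨fun e => supp e.1 e.2, fun e => hsupp e.1 e.2, fun Q π hπ => ?_⟩
  choose S hS hSL using fun i => hS i Q π ⟨hπ.finite, hπ.surjective, hπ.preimage_mem⟩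
  refine ⟨fun e => S e.1 e.2, ⟨fun e => (hS e.1).map_rel e.2, fun e => (hS e.1).boxSet_subset e.2⟩,
    validOn_of_mem_leastLogic fun ψ hψ => ?_⟩
  obtain ⟨i, φ, hφ, rfl⟩ := Set.mem_iUnion.1 hψ
  exact (validOn_map _ _ φ).2 (hSL i φ hφ)

/-! ### PDL-like expansions -/

section Sharp

variable {A W Q : Type}

/-- The standard interpretation of the new modalities: composition, union and transitive closure
of relations. -/
def sharpRel (S : A → Q → Q → Prop) : Sharp A → Q → Q → Prop
  | .base e => S e
  | .comp e c => Relation.Comp (S e) (S c)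
  | .union e c => fun q r => S e q r ∨ S c q r
  | .plus e => Relation.TransGen (S e)

theorem SharpAxiom.validOn_sharpRel {φ : Formula (Sharp A)} (h : SharpAxiom φ)
    (S : A → Q → Q → Prop) : ValidOn (sharpRel S) φ := by
  intro V x
  cases h with
  | union e c =>
    refine sat_iff.2 (Iff.trans ?_ sat_and.symm)
    exact ⟨fun h => ⟨fun y hy => h y (.inl hy), fun y hy => h y (.inr hy)⟩,
      fun h y hy => hy.elim (h.1 y) (h.2 y)⟩
  | comp e c =>
    exact sat_iff.2 ⟨fun h y hy z hz => h z ⟨y, hy, hz⟩, fun h z ⟨y, hy, hz⟩ => h y hy z hz⟩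
  | plusSub e => exact fun h y hy => h y (.single hy)
  | plusStep e => exact fun h y hy z hz => h z (.head hy hz)
  | plusInd e =>
    intro hstep hbase y hy
    induction hy with
    | single hy => exact hbase _ hy
    | tail hy hz ih => exact hstep _ hy ih _ hz

theorem subset_boxSet_plus {S : A → Q → Q → Prop} {e : A} {s t : Set Q}
    (hs : t ⊆ boxSet S e s) (ht : t ⊆ boxSet S e t) : t ⊆ boxSet (sharpRel S) (.plus e) s := by
  intro q hq r hqr
  suffices r ∈ s ∧ r ∈ t from this.1
  induction hqr with
  | single h => exact ⟨hs hq _ h, ht hq _ h⟩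
  | tail _ h ih => exact ⟨hs ih.2 _ h, ht ih.2 _ h⟩

namespace GeneralFrame

variable {F : GeneralFrame (Sharp A)} {X : Set F.W}

theorem boxSet_union (hF : ∀ φ, SharpAxiom φ → F.Valid φ) (hX : X ∈ F.admissible) (e c : A) :
    boxSet F.rel (.union e c) X = boxSet F.rel (.base e) X ∩ boxSet F.rel (.base c) X :=
  Set.ext fun x => (sat_iff.1 ((hF _ (.union e c)).sat_const hX x)).trans sat_and

theorem boxSet_comp (hF : ∀ φ, SharpAxiom φ → F.Valid φ) (hX : X ∈ F.admissible) (e c : A) :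
    boxSet F.rel (.comp e c) X = boxSet F.rel (.base e) (boxSet F.rel (.base c) X) :=
  Set.ext fun x => sat_iff.1 ((hF _ (.comp e c)).sat_const hX x)

theorem boxSet_plus_subset_boxSet (hF : ∀ φ, SharpAxiom φ → F.Valid φ) (hX : X ∈ F.admissible)
    (e : A) : boxSet F.rel (.plus e) X ⊆ boxSet F.rel (.base e) X :=
  (hF _ (.plusSub e)).sat_const hX

theorem boxSet_plus_subset_boxSet_boxSet_plus (hF : ∀ φ, SharpAxiom φ → F.Valid φ)
    (hX : X ∈ F.admissible) (e : A) :
    boxSet F.rel (.plus e) X ⊆ boxSet F.rel (.base e) (boxSet F.rel (.plus e) X) :=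
  (hF _ (.plusStep e)).sat_const hX

theorem boxSet_subset_boxSet_plus (hF : ∀ φ, SharpAxiom φ → F.Valid φ) (hX : X ∈ F.admissible)
    {e : A} (hstep : X ⊆ boxSet F.rel (.base e) X) :
    boxSet F.rel (.base e) X ⊆ boxSet F.rel (.plus e) X :=
  fun x => (hF _ (.plusInd e)).sat_const hX x fun _ _ hy => hstep hy

end GeneralFrame

/-- The support for the expanded alphabet that is generated from a support for the old one. -/
def sharpSupport (R : Sharp A → W → W → Prop) (supp : A → Set W → Set (Set W)) :
    Sharp A → Set W → Set (Set W)
  | .base e, X => supp e X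
  | .comp e c, X => supp c X ∪ supp e (boxSet R (.base c) X)
  | .union e c, X => supp e X ∪ supp c X
  | .plus e, X => insert (boxSet R (.plus e) X) (supp e X ∪ supp e (boxSet R (.plus e) X))

theorem GeneralFrame.IsFiniteSupport.sharpSupport {F : GeneralFrame (Sharp A)}
    {supp : A → Set F.W → Set (Set F.W)} (h : (F.reindex Sharp.base).IsFiniteSupport supp) :
    F.IsFiniteSupport (sharpSupport F.rel supp) := by
  have union {e c : A} {X Y : Set F.W} (hX : X ∈ F.admissible) (hY : Y ∈ F.admissible) :
      (supp e X ∪ supp c Y).Finite ∧ supp e X ∪ supp c Y ⊆ F.admissible :=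
    ⟨(h e X hX).1.union (h c Y hY).1, Set.union_subset (h e X hX).2 (h c Y hY).2⟩
  rintro (e | ⟨e, c⟩ | ⟨e, c⟩ | e) X hX
  · exact h e X hX
  · exact union hX (F.boxSet_mem _ X hX)
  · exact union hX hX
  · have hbox := F.boxSet_mem (.plus e) X hX
    exact ⟨(union hX hbox).1.insert _, Set.insert_subset hbox (union hX hbox).2⟩

theorem IsFiltration.map_rel_sharpRel {F : GeneralFrame (Sharp A)}
    {supp : A → Set F.W → Set (Set F.W)} {π : F.W → Q} {S : A → Q → Q → Prop}
    (hF : ∀ φ, SharpAxiom φ → F.Valid φ) (hπ : F.IsFiniteQuotient π)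
    (hS : IsFiltration (fun e => F.rel (.base e)) supp π S) (e : Sharp A) (x y : F.W)
    (hxy : F.rel e x y) : sharpRel S e (π x) (π y) := by
  have reachable_mem := hπ.preimage_mem {q | sharpRel S e (π x) q}
  suffices x ∈ boxSet F.rel e (π ⁻¹' {q | sharpRel S e (π x) q}) from this y hxy
  cases e with
  | base e => exact hS.map_rel e x
  | comp e c =>
    rw [F.boxSet_comp hF reachable_mem]
    exact fun y hy z hz => ⟨π y, hS.map_rel e x y hy, hS.map_rel c y z hz⟩
  | union e c =>
    rw [F.boxSet_union hF reachable_mem]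
    exact ⟨fun y hy => .inl (hS.map_rel e x y hy), fun y hy => .inr (hS.map_rel c x y hy)⟩
  | plus e =>
    exact F.boxSet_subset_boxSet_plus hF reachable_mem
      (fun y hy z hz => .tail hy (hS.map_rel e y z hz)) fun y hy => .single (hS.map_rel e x y hy)

theorem IsFiltration.sharpRel {F : GeneralFrame (Sharp A)} {supp : A → Set F.W → Set (Set F.W)}
    {π : F.W → Q} {S : A → Q → Q → Prop} (hF : ∀ φ, SharpAxiom φ → F.Valid φ)
    (hπ : F.IsFiniteQuotient π) (hS : IsFiltration (fun e => F.rel (.base e)) supp π S) :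
    IsFiltration F.rel (sharpSupport F.rel supp) π (sharpRel S) := by
  refine ⟨hS.map_rel_sharpRel hF hπ, fun e s hs => ?_⟩
  have hbox {e : A} {s : Set Q} : supp e (π ⁻¹' s) ⊆ saturatedSets π →
    boxSet F.rel (.base e) (π ⁻¹' s) = π ⁻¹' boxSet S e s := hS.boxSet_preimage
  have hs_mem := hπ.preimage_mem s
  cases e with
  | base e => exact hS.boxSet_subset e s hs
  | comp e c =>
    obtain ⟨hc, he⟩ := Set.union_subset_iff.1 hs
    rw [hbox hc] at he
    rw [F.boxSet_comp hF hs_mem, hbox hc, hbox he]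
    rintro x hx _ ⟨r, hr, hr'⟩
    exact hx r hr _ hr'
  | union e c =>
    obtain ⟨he, hc⟩ := Set.union_subset_iff.1 hs
    rw [F.boxSet_union hF hs_mem, hbox he, hbox hc]
    exact fun x hx r hr => hr.elim (hx.1 r) (hx.2 r)
  | plus e =>
    obtain ⟨⟨t, ht⟩, he⟩ := Set.insert_subset_iff.1 hs
    obtain ⟨hs, ht'⟩ := Set.union_subset_iff.1 he
    have hts := F.boxSet_plus_subset_boxSet hF hs_mem e
    have htt := F.boxSet_plus_subset_boxSet_boxSet_plus hF hs_mem e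
    rw [← ht] at ht' hts htt ⊢
    rw [hbox hs, hπ.surjective.preimage_subset_preimage_iff] at hts
    rw [hbox ht', hπ.surjective.preimage_subset_preimage_iff] at htt
    exact Set.preimage_mono (subset_boxSet_plus hts htt)

theorem AdmitsFiltration.sharpLogic {L : Set (Formula A)} (hL : AdmitsFiltration L) :
    AdmitsFiltration (sharpLogic L) := by
  intro F hF
  have valid_axiom : ∀ φ, SharpAxiom φ → F.Valid φ := fun φ hφ =>
    hF φ (subset_leastLogic _ (.inr hφ))
  have valid_reindex : ∀ φ ∈ L, (F.reindex Sharp.base).Valid φ := fun φ hφ =>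
    GeneralFrame.valid_map.1 (hF _ (subset_leastLogic _ (.inl ⟨φ, hφ, rfl⟩)))
  obtain ⟨supp, hsupp, hS⟩ := hL _ valid_reindex
  refine ⟨sharpSupport F.rel supp, hsupp.sharpSupport, fun Q π hπ => ?_⟩
  obtain ⟨S, hS, hSL⟩ := hS Q π ⟨hπ.finite, hπ.surjective, hπ.preimage_mem⟩
  refine ⟨sharpRel S, hS.sharpRel valid_axiom hπ, validOn_of_mem_leastLogic ?_⟩
  rintro _ (⟨φ, hφ, rfl⟩ | hφ)
  · exact (validOn_map _ _ φ).2 (hSL φ hφ)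
  · exact hφ.validOn_sharpRel S

theorem AdmitsFiltration.iterLogic {L : Set (Formula A)} (hL : AdmitsFiltration L) (n : ℕ) :
    AdmitsFiltration (iterLogic L n) := by
  induction n with
  | zero => exact hL
  | succ n ih => exact ih.sharpLogic

theorem IsNormalLogic.iterLogic {L : Set (Formula A)} (hL : IsNormalLogic L) (n : ℕ) :
    IsNormalLogic (iterLogic L n) := by
  cases n with
  | zero => exact hL
  | succ n => exact isNormalLogic_leastLogic _

end Sharp

/-! ### The canonical general frame -/

section Canonical

variable {A : Type} {L : Set (Formula A)}

/-- Closure under modus ponens. -/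
def MPClosed (T : Set (Formula A)) : Prop := ∀ φ ψ, imp φ ψ ∈ T → φ ∈ T → ψ ∈ T

theorem MPClosed.exists_maximal_notMem {T : Set (Formula A)} {φ : Formula A} (hT : MPClosed T)
    (hφ : φ ∉ T) : ∃ M, T ⊆ M ∧ Maximal (fun U => MPClosed U ∧ φ ∉ U) M := by
  refine zorn_subset_nonempty {U | MPClosed U ∧ φ ∉ U} (fun c hc hchain _ =>
    ⟨⋃₀ c, ⟨?_, ?_⟩, fun U => Set.subset_sUnion_of_mem⟩) T ⟨hT, hφ⟩
  · rintro α β ⟨U, hU, hαβ⟩ ⟨U', hU', hα⟩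
    obtain h | h := hchain.total hU hU'
    · exact ⟨U', hU', (hc hU').1 α β (h hαβ) hα⟩
    · exact ⟨U, hU, (hc hU).1 α β hαβ (h hα)⟩
  · rintro ⟨U, hU, hφU⟩
    exact (hc hU).2 hφU

theorem imp_mem_of_maximal {M : Set (Formula A)} {φ ψ : Formula A}
    (hM : Maximal (fun U => MPClosed U ∧ φ ∉ U) M) (taut : ∀ χ, IsTautology χ → χ ∈ M)
    (hψ : ψ ∉ M) : imp ψ φ ∈ M := by
  have mp := hM.prop.1
  have subset : M ⊆ {χ | imp ψ χ ∈ M} := fun χ =>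
    mp χ _ (taut (imp χ (imp ψ χ)) fun _ hχ _ => hχ)
  have closed : MPClosed {χ | imp ψ χ ∈ M} := fun α β hαβ => mp _ _ <| mp _ _
    (taut (imp (imp ψ (imp α β)) (imp (imp ψ α) (imp ψ β))) fun _ h h' h'' => h h'' (h' h'')) hαβ
  by_contra hφ
  exact hψ (hM.le_of_ge ⟨closed, hφ⟩ subset (taut (imp ψ ψ) fun _ h => h))

theorem exists_canonPoint (hL : IsNormalLogic L) {T : Set (Formula A)} (hLT : L ⊆ T)
    (hT : MPClosed T) {φ : Formula A} (hφ : φ ∉ T) :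
    ∃ x : CanonPoint L, T ⊆ x.carrier ∧ φ ∉ x.carrier := by
  obtain ⟨M, hTM, hM⟩ := hT.exists_maximal_notMem hφ
  obtain ⟨mp, hφM⟩ := hM.prop
  have taut (ψ : Formula A) (hψ : IsTautology ψ) : ψ ∈ M := hTM (hLT (hL.taut ψ hψ))
  refine ⟨⟨M, hLT.trans hTM, mp, fun ψ hψ => ?_, fun ψ => ?_⟩, hTM, hφM⟩
  · exact hφM (mp _ _ (taut (imp bot φ) fun _ h => h.elim) (mp _ _ hψ.2 hψ.1))
  · by_contra! hψ
    have cases_taut : IsTautology (imp (imp ψ φ) (imp (imp (neg ψ) φ) φ)) := fun v h h' =>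
      (Classical.em (boolEval v ψ)).elim h h'
    exact hφM (mp _ _ (mp _ _ (taut _ cases_taut) (imp_mem_of_maximal hM taut hψ.1))
      (imp_mem_of_maximal hM taut hψ.2))

namespace CanonPoint

theorem neg_mem_iff (x : CanonPoint L) {φ : Formula A} : neg φ ∈ x.carrier ↔ φ ∉ x.carrier :=
  ⟨fun hn hφ => x.consistent φ ⟨hφ, hn⟩, (x.complete φ).resolve_left⟩

theorem bot_notMem (hL : IsNormalLogic L) (x : CanonPoint L) : bot ∉ x.carrier :=
  x.neg_mem_iff.1 (x.contains (hL.taut _ fun _ h => h))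

theorem imp_mem_iff (hL : IsNormalLogic L) (x : CanonPoint L) {φ ψ : Formula A} :
    imp φ ψ ∈ x.carrier ↔ (φ ∈ x.carrier → ψ ∈ x.carrier) := by
  refine ⟨x.mp φ ψ, fun h => ?_⟩
  by_cases hφ : φ ∈ x.carrier
  · exact x.mp _ _ (x.contains (hL.taut (imp ψ (imp φ ψ)) fun _ hψ _ => hψ)) (h hφ)
  · exact x.mp _ _ (x.contains (hL.taut (imp (neg φ) (imp φ ψ)) fun _ hn hφ => (hn hφ).elim))
      (x.neg_mem_iff.2 hφ)

theorem and_mem_iff (hL : IsNormalLogic L) (x : CanonPoint L) {φ ψ : Formula A} :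
    Formula.and φ ψ ∈ x.carrier ↔ φ ∈ x.carrier ∧ ψ ∈ x.carrier := by
  rw [Formula.and, neg_mem_iff, imp_mem_iff hL, neg_mem_iff, Classical.not_imp, not_not]

theorem box_mem_iff (hL : IsNormalLogic L) (x : CanonPoint L) {e : A} {φ : Formula A} :
    box e φ ∈ x.carrier ↔ ∀ y, canonRel L e x y → φ ∈ y.carrier := by
  refine ⟨fun h y hy => hy φ h, fun h => ?_⟩
  by_contra hφ
  have closed : MPClosed {χ | box e χ ∈ x.carrier} := fun α β hαβ =>
    x.mp _ _ (x.mp _ _ (x.contains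
      (hL.substitution (fun n => if n = 0 then α else β) _ (hL.axK e))) hαβ)
  obtain ⟨y, hy, hφy⟩ := exists_canonPoint hL (T := {χ | box e χ ∈ x.carrier})
    (fun χ hχ => x.contains (hL.nec e χ hχ)) closed hφ
  exact hφy (h y hy)

end CanonPoint

theorem sat_canonRel_iff (hL : IsNormalLogic L) (σ : ℕ → Formula A) (φ : Formula A)
    (x : CanonPoint L) :
    Sat (canonRel L) (fun n y => σ n ∈ y.carrier) φ x ↔ φ.subst σ ∈ x.carrier := by
  induction φ generalizing x with
  | bot => exact (iff_false_intro (x.bot_notMem hL)).symm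
  | var n => rfl
  | imp φ ψ ihφ ihψ => exact (imp_congr (ihφ x) (ihψ x)).trans (x.imp_mem_iff hL).symm
  | box e φ ih => exact (forall₂_congr fun y _ => ih y).trans (x.box_mem_iff hL).symm

theorem subst_var (φ : Formula A) : φ.subst var = φ := by
  induction φ with
  | bot => rfl
  | var n => rfl
  | imp φ ψ ihφ ihψ => exact congrArg₂ imp ihφ ihψ
  | box e φ ih => exact congrArg (box e) ih

/-- The canonical frame of `L`, where the admissible sets are the sets of all points that contain
a given formula. -/
def canonGeneralFrame (hL : IsNormalLogic L) [h : Nonempty (CanonPoint L)] : GeneralFrame A where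
  W := CanonPoint L
  nonempty := h
  rel := canonRel L
  admissible :=
    { carrier := Set.range fun φ => {x | φ ∈ x.carrier}
      supClosed' := by
        rintro _ ⟨φ, rfl⟩ _ ⟨ψ, rfl⟩
        refine ⟨imp (neg φ) ψ, Set.ext fun x => (x.imp_mem_iff hL).trans ?_⟩
        rw [x.neg_mem_iff]
        exact or_iff_not_imp_left.symm
      infClosed' := by
        rintro _ ⟨φ, rfl⟩ _ ⟨ψ, rfl⟩
        exact ⟨Formula.and φ ψ, Set.ext fun x => x.and_mem_iff hL⟩
      compl_mem' := by
        rintro _ ⟨φ, rfl⟩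
        exact ⟨neg φ, Set.ext fun x => x.neg_mem_iff⟩
      bot_mem' := ⟨bot, Set.eq_empty_of_forall_notMem fun x => x.bot_notMem hL⟩ }
  boxSet_mem := by
    rintro e _ ⟨φ, rfl⟩
    exact ⟨box e φ, Set.ext fun x => x.box_mem_iff hL⟩

theorem valid_canonGeneralFrame (hL : IsNormalLogic L) [Nonempty (CanonPoint L)]
    {φ : Formula A} (hφ : φ ∈ L) : (canonGeneralFrame hL).Valid φ := by
  intro V hV x
  choose σ hσ using hV
  obtain rfl : (fun n (y : CanonPoint L) => σ n ∈ y.carrier) = V :=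
    funext₂ fun n y => propext (Set.ext_iff.1 (hσ n) y)
  exact (sat_canonRel_iff hL σ φ x).2 (x.contains (hL.substitution σ φ hφ))

end Canonical

/-! ### The finite model property -/

theorem exists_finite_forall_sat_iff {A : Type} {F : GeneralFrame A}
    {supp : A → Set F.W → Set (Set F.W)} (hsupp : F.IsFiniteSupport supp) {V : ℕ → F.W → Prop}
    (hV : ∀ n, {x | V n x} ∈ F.admissible) (φ : Formula A) :
    ∃ K : Set (Set F.W), K.Finite ∧ K ⊆ F.admissible ∧
      ∀ (Q : Type) (π : F.W → Q) (S : A → Q → Q → Prop), Function.Surjective π →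
        IsFiltration F.rel supp π S → K ⊆ saturatedSets π →
          ∀ x, Sat S (fun n => π '' {x | V n x}) φ (π x) ↔ Sat F.rel V φ x := by
  induction φ with
  | bot => exact ⟨∅, Set.finite_empty, Set.empty_subset _, fun _ _ _ _ _ _ _ => Iff.rfl⟩
  | var n =>
    refine ⟨{{x | V n x}}, Set.finite_singleton _, Set.singleton_subset_iff.2 (hV n),
      fun Q π S hπ _ hK x => ?_⟩
    obtain ⟨s, hs⟩ := Set.singleton_subset_iff.1 hK
    change π x ∈ π '' {x | V n x} ↔ x ∈ {x | V n x}
    rw [← hs, Set.image_preimage_eq s hπ, Set.mem_preimage]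
  | imp φ ψ ihφ ihψ =>
    obtain ⟨K₁, hK₁, hK₁F, h₁⟩ := ihφ
    obtain ⟨K₂, hK₂, hK₂F, h₂⟩ := ihψ
    refine ⟨K₁ ∪ K₂, hK₁.union hK₂, Set.union_subset hK₁F hK₂F, fun Q π S hπ hS hK x => ?_⟩
    obtain ⟨hK₁, hK₂⟩ := Set.union_subset_iff.1 hK
    exact imp_congr (h₁ Q π S hπ hS hK₁ x) (h₂ Q π S hπ hS hK₂ x)
  | box e φ ih =>
    obtain ⟨K, hK, hKF, h⟩ := ih
    obtain ⟨hfin, hadm⟩ := hsupp e _ (F.setOf_sat_mem hV φ)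
    refine ⟨K ∪ supp e {x | Sat F.rel V φ x}, hK.union hfin, Set.union_subset hKF hadm,
      fun Q π S hπ hS hKe x => ?_⟩
    obtain ⟨hK, he⟩ := Set.union_subset_iff.1 hKe
    have truthSet : {x | Sat F.rel V φ x}
        = π ⁻¹' {q | Sat S (fun n => π '' {x | V n x}) φ q} :=
      Set.ext fun y => (h Q π S hπ hS hK y).symm
    rw [truthSet] at he
    have hbox := hS.boxSet_preimage he
    rw [← truthSet] at hbox
    exact (Set.ext_iff.1 hbox x).symm

theorem AdmitsFiltration.hasFMP {A : Type} {L : Set (Formula A)} (hf : AdmitsFiltration L)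
    (hL : IsNormalLogic L) : HasFMP L := by
  refine ⟨{F | Finite F.W ∧ ∀ φ ∈ L, F.Valid φ}, fun F hF => hF.1,
    Set.Subset.antisymm (fun φ hφ F hF => hF.2 φ hφ) fun φ hφ => ?_⟩
  by_contra hφL
  obtain ⟨x, -, hφx⟩ := exists_canonPoint hL subset_rfl hL.mp hφL
  have : Nonempty (CanonPoint L) := ⟨x⟩
  let F := canonGeneralFrame hL
  let V : ℕ → F.W → Prop := fun n y => var n ∈ CanonPoint.carrier y
  obtain ⟨supp, hsupp, hS⟩ := hf F fun φ => valid_canonGeneralFrame hL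
  obtain ⟨K, hK, hKF, sat_iff_sat⟩ :=
    exists_finite_forall_sat_iff hsupp (V := V) (fun n => ⟨var n, rfl⟩) φ
  obtain ⟨Q, π, hπ, hKπ⟩ := F.exists_isFiniteQuotient hK hKF
  obtain ⟨S, hS, hSL⟩ := hS Q π hπ
  have sat_quotient : Sat S (fun n => π '' {y | V n y}) φ (π x) :=
    hφ ⟨Q, ⟨π x⟩, S⟩ ⟨hπ.finite, hSL⟩ _ _
  have sat_canon : Sat F.rel V φ x := (sat_iff_sat Q π S hπ.surjective hS hKπ x).1 sat_quotient
  exact hφx (subst_var φ ▸ (sat_canonRel_iff hL var φ x).1 sat_canon)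

end PDLization

theorem mainTheorem9_general {ι : Type} {A : ι → Type} (L : ∀ i, Set (PDLization.Formula (A i)))
    (hL : ∀ i, PDLization.IsT4BLogic (L i) ∨ PDLization.IsCanonicalMFPLogic (L i)) (n : ℕ) :
    PDLization.HasFMP (PDLization.iterLogic (PDLization.iFusion L) n) := by
  have admits (i : ι) : PDLization.AdmitsFiltration (L i) :=
    (hL i).elim PDLization.IsT4BLogic.admitsFiltration
      PDLization.IsCanonicalMFPLogic.admitsFiltration
  have normal : PDLization.IsNormalLogic (PDLization.iFusion L) :=
    PDLization.isNormalLogic_leastLogic _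
  exact ((PDLization.AdmitsFiltration.iFusion admits).iterLogic n).hasFMP (normal.iterLogic n)

theorem mainTheorem9 (k : ℕ) (A : Fin k → Type) [∀ i, Finite (A i)]
    (L : ∀ i, Set (PDLization.Formula (A i)))
    (hL : ∀ i, PDLization.IsBasicUnimodal (L i) ∨ PDLization.IsCanonicalMFPLogic (L i))
    (n : ℕ) :
    PDLization.HasFMP (PDLization.iterLogic (PDLization.fusion L) n) :=
  mainTheorem9_general L (fun i => (hL i).imp_left PDLization.IsBasicUnimodal.isT4BLogic) n
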